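/- All fusion categories are over $\mathbb{C}$: abelian, $\mathbb{C}$-linear, semisimple, rigid monoidal categories with finitely many isomorphism classes of simple objects, finite-dimensional Hom spaces and simple unit object $1$. A fusion subcategory is a full replete monoidal subcategory that is itself a fusion category. A ($\mathbb{C}$-linear, strong monoidal) tensor functor $F:\mathcal{C}\to\mathcal{E}$ between fusion categories is called normal if, for every simple object $X$ of $\mathcal{C}$ with $\operatorname{Hom}_{\mathcal{E}}(1,F(X))\neq 0$, one has $F(X)\cong 1^{\oplus \mathrm{FPdim}(X)}$ (in particular $\mathrm{FPdim}(X)$ is an integer), where $\mathrm{FPdim}(X)$ is the Frobenius--Perron eigenvalue of left multiplication by $[X]$ on the Grothendieck ring of $\mathcal{C}$. Its kernel $\ker F$ is the fusion subcategory of $\mathcal{C}$ generated by all simple $X$ with $F(X)\cong 1^{\oplus \mathrm{FPdim}(X)}$. A fusion subcategory $\mathcal{D}\subseteq\mathcal{C}$ is called normal if $\mathcal{D}=\ker F$ for some normal tensor functor $F$ from $\mathcal{C}$ to a fusion category. For fusion subcategories $\mathcal{D},\mathcal{D}'$ of $\mathcal{C}$ and an object $X$, let $\mathcal{D}X\mathcal{D}'$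 be the set of simple objects $Y$ of $\mathcal{C}$ that are constituents of $D\otimes X\otimes D'$ for some simple $D\in\mathcal{D}$ and $D'\in\mathcal{D}'$; for simple $X$ this is the double coset of $X$. Put $\mathcal{D}X=\mathcal{D}X\,\mathrm{Vec}$ (left coset) and $X\mathcal{D}=\mathrm{Vec}\,X\mathcal{D}$ (right coset), where $\mathrm{Vec}$ is the subcategory of multiples of $1$. **Proposition.** Let $G$ be a group and let $\mathcal{C}=\bigoplus_{g\in G}\mathcal{C}_g$ be a $G$-graded fusion category; that is, the $\mathcal{C}_g$ are (possibly zero) replete full abelian subcategories, closed under finite direct sums, subobjects and quotients, $\mathcal{C}$ is their direct sum, and $\mathcal{C}_g\otimes\mathcal{C}_h\subseteq\mathcal{C}_{gh}$ for all $g,h\in G$. Assume that $\mathcal{C}_1$ is a normal fusion subcategory of $\mathcal{C}$. Then for every $g\in G$ and every nonzero object $X_g$ of $\mathcal{C}_g$ (in particular every simple one), the set of simple objects of $\mathcal{C}_g$ equals $$\mathcal{C}_1X_g \;=\; X_g\,\mathcal{C}_1 \;=\; \mathcal{C}_1X_g\,\mathcal{C}_1 ,$$ and $\mathcal{C}_g$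 is the full subcategory of all objects of $\mathcal{C}$ whose simple constituents all lie in this set. -/

import Mathlib

open CategoryTheory CategoryTheory.Limits CategoryTheory.MonoidalCategory

universe w v u v' u'

noncomputable section

namespace FusionCoset

section FusionCategories

/-- The set of isomorphism classes of simple objects of a category. -/
def SimpleClass (C : Type u) [Category.{v} C] [HasZeroMorphisms C] : Type u :=
  Quotient (isIsomorphicSetoid (ObjectProperty.FullSubcategory (fun X : C => Simple X)))

/-- A chosen representative of an isomorphism class of simple objects. -/
def SimpleClass.rep {C : Type u} [Category.{v} C] [HasZeroMorphisms C] (c : SimpleClass C) : C :=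
  (Quotient.out c).obj

/-- A fusion category (over the complex numbers): an abelian, `ℂ`-linear, semisimple, rigid
monoidal category (with bilinear tensor product) having finitely many isomorphism classes of
simple objects, finite-dimensional spaces of morphisms and a simple unit object.
The first five fields say that the preadditive category `C` is abelian. -/
class FusionCategory (C : Type u) [Category.{v} C] [Preadditive C] [Linear ℂ C]
    [MonoidalCategory C] [MonoidalPreadditive C] [MonoidalLinear ℂ C] : Prop where
  hasFiniteBiproducts : HasFiniteBiproducts C
  hasKernels : HasKernels C
  hasCokernels : HasCokernels C
  isNormalMono : IsNormalMonoCategory C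
  isNormalEpi : IsNormalEpiCategory C
  semisimple : ∀ X : C, ∃ (n : ℕ) (S : Fin n → C),
    (∀ i, Simple (S i)) ∧ Nonempty (X ≅ ⨁ S)
  rigid : Nonempty (RigidCategory C)
  finite_simples : Finite (SimpleClass C)
  finiteDimensional_hom : ∀ X Y : C, FiniteDimensional ℂ (X ⟶ Y)
  simple_unit : Simple (𝟙_ C)

attribute [instance] FusionCategory.hasFiniteBiproducts FusionCategory.finite_simples

variable {C : Type u} [Category.{v} C] [Preadditive C] [Linear ℂ C]
  [MonoidalCategory C] [MonoidalPreadditive C] [MonoidalLinear ℂ C]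

/-- A fusion subcategory: a full monoidal replete subcategory which is itself
a fusion category. -/
def IsFusionSubcategory (P : ObjectProperty C) : Prop :=
  P.IsClosedUnderIsomorphisms ∧ ∃ _ : P.IsMonoidal, FusionCategory P.FullSubcategory

/-- The fusion subcategory generated by a class of objects: the intersection of all
fusion subcategories containing it. -/
def generatedFusionSubcategory (Q : ObjectProperty C) : ObjectProperty C :=
  fun X => ∀ P : ObjectProperty C, IsFusionSubcategory P → Q ≤ P → P X

/-- `Y` is a (simple) constituent of `Z`: it is a simple object that embeds into `Z`. -/
def IsConstituent (Y Z : C) : Prop :=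
  Simple Y ∧ ∃ f : Y ⟶ Z, Mono f

variable [FusionCategory C]

/-- The matrix of left multiplication by `[X]` on the Grothendieck ring, in the basis of
isomorphism classes of simple objects; its `(a, b)` entry is the multiplicity of
`a` in `X ⊗ b`. -/
def leftMulMatrix (X : C) : Matrix (SimpleClass C) (SimpleClass C) ℂ :=
  fun a b => (Module.finrank ℂ (a.rep ⟶ X ⊗ b.rep) : ℂ)

open Classical in
/-- The Frobenius-Perron dimension of `X`: the Frobenius-Perron eigenvalue (that is, the
spectral radius) of the nonnegative matrix of left multiplication by `[X]`. -/
def fpDim (X : C) : ℝ :=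
  letI : Fintype (SimpleClass C) := Fintype.ofFinite _
  (spectralRadius ℂ (leftMulMatrix X)).toReal

/-- The object `1 ⊕ ⋯ ⊕ 1` (`n` summands). -/
def unitPower (C : Type u) [Category.{v} C] [Preadditive C] [Linear ℂ C]
    [MonoidalCategory C] [MonoidalPreadditive C] [MonoidalLinear ℂ C] [FusionCategory C]
    (n : ℕ) : C :=
  ⨁ (fun _ : Fin n => 𝟙_ C)

/-- The fusion subcategory `Vec` of multiples of the unit object. -/
def vecSubcategory (C : Type u) [Category.{v} C] [Preadditive C] [Linear ℂ C]
    [MonoidalCategory C] [MonoidalPreadditive C] [MonoidalLinear ℂ C] [FusionCategory C] :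
    ObjectProperty C :=
  fun X => ∃ n : ℕ, Nonempty (X ≅ unitPower C n)

/-- `D X E`: the set of all simple objects that are constituents of `D ⊗ X ⊗ E` for some simple
objects `D` of `𝒟` and `E` of `ℰ`. For simple `X` and fusion subcategories `𝒟`, `ℰ`, this is
the double coset of `X`, the class of `X` under the equivalence relation
on simple objects defined by `𝒟` and `ℰ`. -/
def doubleCoset (𝒟 ℰ : ObjectProperty C) (X : C) : Set C :=
  {Y | ∃ D E : C, Simple D ∧ 𝒟 D ∧ Simple E ∧ ℰ E ∧ IsConstituent Y ((D ⊗ X) ⊗ E)}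

/-- The left coset `𝒟 X`. -/
def leftCoset (𝒟 : ObjectProperty C) (X : C) : Set C :=
  doubleCoset 𝒟 (vecSubcategory C) X

/-- The right coset `X ℰ`. -/
def rightCoset (ℰ : ObjectProperty C) (X : C) : Set C :=
  doubleCoset (vecSubcategory C) ℰ X

/-- The set of simple objects of a full subcategory. -/
def simplesOf (P : ObjectProperty C) : Set C :=
  {Y | Simple Y ∧ P Y}

/-- The full subcategory of all objects whose simple constituents lie in `S`. -/
def spannedBy (S : Set C) : ObjectProperty C :=
  fun Z => ∀ Y : C, IsConstituent Y Z → Y ∈ S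

/-- A `G`-grading `C = ⨁ C_g`, where `C_g` is the full subcategory with objects `P g`:
the `C_g` are replete full abelian subcategories (closed under finite
direct sums, including the empty one, subobjects and quotients), `C` is their direct sum as a category
(there are no nonzero morphisms between different components, and every object is a finite
direct sum of objects of the components), and `C_g ⊗ C_h ⊆ C_{gh}`.
Components are allowed to be zero. -/
structure IsGrading {G : Type*} [Group G] (P : G → ObjectProperty C) : Prop where
  iso : ∀ g, (P g).IsClosedUnderIsomorphisms
  biproduct : ∀ (g : G) (n : ℕ) (Y : Fin n → C), (∀ i, P g (Y i)) → P g (⨁ Y)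
  sub : ∀ g, (P g).IsClosedUnderSubobjects
  quot : ∀ g, (P g).IsClosedUnderQuotients
  hom_eq_zero : ∀ (g h : G), g ≠ h → ∀ (X Y : C), P g X → P h Y → ∀ f : X ⟶ Y, f = 0
  decomposition : ∀ X : C, ∃ (n : ℕ) (g : Fin n → G) (Y : Fin n → C),
    Function.Injective g ∧ (∀ i, P (g i) (Y i)) ∧ Nonempty (X ≅ ⨁ Y)
  tensor : ∀ (g h : G) (X Y : C), P g X → P h Y → P (g * h) (X ⊗ Y)

end FusionCategories

section NormalFunctors

variable {C : Type u} [Category.{v} C] [Preadditive C] [Linear ℂ C]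
  [MonoidalCategory C] [MonoidalPreadditive C] [MonoidalLinear ℂ C] [FusionCategory C]
  {E : Type u'} [Category.{v'} E] [Preadditive E] [Linear ℂ E]
  [MonoidalCategory E] [MonoidalPreadditive E] [MonoidalLinear ℂ E] [FusionCategory E]

/-- `F(X) = FPdim(X) 1`. -/
def TrivializedBy (F : C ⥤ E) (X : C) : Prop :=
  ∃ n : ℕ, (n : ℝ) = fpDim X ∧ Nonempty (F.obj X ≅ unitPower E n)

/-- A functor `F` is normal if `F(X) = FPdim(X) 1` for every simple object `X` such that `1`
is a constituent of `F(X)`. -/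
def IsNormalFunctor (F : C ⥤ E) : Prop :=
  ∀ X : C, Simple X → 0 < Module.finrank ℂ (𝟙_ E ⟶ F.obj X) → TrivializedBy F X

/-- The kernel of `F`: the fusion subcategory generated by all simple objects `X` such that
`F(X) = FPdim(X) 1`. -/
def kernel (F : C ⥤ E) : ObjectProperty C :=
  generatedFusionSubcategory (fun X => Simple X ∧ TrivializedBy F X)

/-- A fusion subcategory of `C` is normal if it is the kernel of a normal tensor functor from `C`
to some fusion category. -/
def IsNormalFusionSubcategory (P : ObjectProperty C) : Prop :=
  IsFusionSubcategory P ∧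
    ∃ (E : Type u') (_ : Category.{v'} E) (_ : Preadditive E) (_ : Linear ℂ E)
      (_ : MonoidalCategory E) (_ : MonoidalPreadditive E) (_ : MonoidalLinear ℂ E)
      (_ : FusionCategory E) (F : C ⥤ E) (_ : F.Monoidal),
      F.Additive ∧ F.Linear ℂ ∧ IsNormalFunctor F ∧ P = kernel F

end NormalFunctors

end FusionCoset

end

/-!
Every simple object `Y` of `C_g` is a constituent of `D ⊗ X` for a simple object `D` of `C_1`.
Since `X ≠ 0` and the unit is simple, the coevaluation `1 ⟶ ᘁX ⊗ X` is a monomorphism, and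
tensoring with the rigid object `Y` preserves this: `Y` embeds into `(Y ⊗ ᘁX) ⊗ X`. Splitting
`Y ⊗ ᘁX` into simple objects `D`, some component `Y ⟶ D ⊗ X` is nonzero, hence a monomorphism
(`exists_simple_mono_tensor_right`). The simple object `D` is homogeneous, say of degree `h`
(`IsGrading.exists_mem_of_simple`); as there is a nonzero morphism from `Y ∈ C_g` to
`D ⊗ X ∈ C_{hg}`, the degrees agree (`IsGrading.eq_of_mono`) and `h = 1`. The degree of the dual
of `X` is thus never needed. The other dual gives the right cosets in the same way.

Conversely `Vec ⊆ C_1`, and `C_1 C_g C_1 ⊆ C_g` since `C_g` is closed under subobjects. Hence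
the left and right cosets lie in the double coset, which lies in the set of simples of `C_g`.
Finally `C_g`, being closed under subobjects and direct sums, is determined by its simple objects
(`IsGrading.eq_spannedBy_simplesOf`).
-/

noncomputable section

namespace FusionCoset

theorem doubleCoset_mono {C : Type u} [Category.{v} C] [Preadditive C] [MonoidalCategory C]
    {𝒟 𝒟' ℰ ℰ' : ObjectProperty C} (h𝒟 : 𝒟 ≤ 𝒟') (hℰ : ℰ ≤ ℰ') (X : C) :
    doubleCoset 𝒟 ℰ X ⊆ doubleCoset 𝒟' ℰ' X := by
  rintro Y ⟨D, E, hD, hD', hE, hE', hY⟩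
  exact ⟨D, E, hD, h𝒟 D hD', hE, hℰ E hE', hY⟩

section Coevaluation

variable {C : Type u} [Category.{v} C] [Preadditive C] [MonoidalCategory C]
  [MonoidalPreadditive C]

/-- By the triangle identity, the identity of `X` factors through the coevaluation. -/
theorem coevaluation_ne_zero_of_left {X X' : C} [ExactPairing X X'] (hX : ¬ IsZero X) :
    η_ X X' ≠ 0 := by
  intro h
  have t := ExactPairing.evaluation_coevaluation X X'
  rw [h, MonoidalPreadditive.zero_whiskerRight, zero_comp] at t
  refine hX ((IsZero.iff_id_eq_zero X).2 ?_)
  have h2 : (λ_ X).inv ≫ ((λ_ X).hom ≫ (ρ_ X).inv) ≫ (ρ_ X).hom = 𝟙 X := by simp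
  rw [← h2, ← t]
  simp

/-- By the other triangle identity, the identity of `X'` factors through the coevaluation. -/
theorem coevaluation_ne_zero_of_right {X X' : C} [ExactPairing X X'] (hX : ¬ IsZero X') :
    η_ X X' ≠ 0 := by
  intro h
  have t := ExactPairing.coevaluation_evaluation X X'
  rw [h, MonoidalPreadditive.whiskerLeft_zero, zero_comp] at t
  refine hX ((IsZero.iff_id_eq_zero X').2 ?_)
  have h2 : (ρ_ X').inv ≫ ((ρ_ X').hom ≫ (λ_ X').inv) ≫ (λ_ X').hom = 𝟙 X' := by simp
  rw [← h2, ← t]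
  simp

end Coevaluation

section FusionCategories

variable {C : Type u} [Category.{v} C] [Preadditive C] [Linear ℂ C]
  [MonoidalCategory C] [MonoidalPreadditive C] [MonoidalLinear ℂ C] [FusionCategory C]

theorem exists_comp_π_ne_zero {n : ℕ} {S : Fin n → C} {A : C} {f : A ⟶ ⨁ S} (hf : f ≠ 0) :
    ∃ i, f ≫ biproduct.π S i ≠ 0 := by
  by_contra! h
  exact hf (biproduct.hom_ext _ _ fun i => by rw [h i, zero_comp])

theorem exists_comp_π_whiskerRight_ne_zero {n : ℕ} {S : Fin n → C} {A X : C}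
    {f : A ⟶ (⨁ S) ⊗ X} (hf : f ≠ 0) : ∃ i, f ≫ biproduct.π S i ▷ X ≠ 0 := by
  by_contra! h
  apply hf
  rw [← Category.comp_id f, ← id_whiskerRight, ← biproduct.total, sum_whiskerRight,
    Preadditive.comp_sum]
  refine Finset.sum_eq_zero fun i _ => ?_
  rw [comp_whiskerRight, ← Category.assoc, h i, zero_comp]

theorem exists_comp_whiskerLeft_π_ne_zero {n : ℕ} {S : Fin n → C} {A X : C}
    {f : A ⟶ X ⊗ (⨁ S)} (hf : f ≠ 0) : ∃ i, f ≫ X ◁ biproduct.π S i ≠ 0 := by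
  by_contra! h
  apply hf
  rw [← Category.comp_id f, ← whiskerLeft_id, ← biproduct.total, whiskerLeft_sum,
    Preadditive.comp_sum]
  refine Finset.sum_eq_zero fun i _ => ?_
  rw [whiskerLeft_comp, ← Category.assoc, h i, zero_comp]

theorem mono_of_simple {Y Z : C} [Simple Y] {f : Y ⟶ Z} (hf : f ≠ 0) : Mono f :=
  have : HasKernels C := FusionCategory.hasKernels
  mono_of_nonzero_from_simple hf

/-- A simple object `Y` embeds into `D ⊗ X` for some simple constituent `D` of `Y ⊗ ᘁX`. -/
theorem exists_simple_mono_tensor_right (X : C) (hX : ¬ IsZero X) (Y : C) [Simple Y] :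
    ∃ (D : C) (f : Y ⟶ D ⊗ X), Simple D ∧ Mono f := by
  obtain ⟨_⟩ := FusionCategory.rigid (C := C)
  have := FusionCategory.simple_unit (C := C)
  have : Mono (η_ (ᘁX) X) := mono_of_simple (coevaluation_ne_zero_of_right hX)
  -- `Y ⊗ -` is a right adjoint, by rigidity of `Y`.
  have := Functor.preservesMonomorphisms_of_adjunction (tensorLeftAdjunction Y (Yᘁ))
  have : Mono (Y ◁ η_ (ᘁX) X) := (tensorLeft Y).map_mono (η_ (ᘁX) X)
  obtain ⟨n, S, hS, ⟨e⟩⟩ := FusionCategory.semisimple (Y ⊗ (ᘁX))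
  let f : Y ⟶ (⨁ S) ⊗ X :=
    (ρ_ Y).inv ≫ Y ◁ η_ (ᘁX) X ≫ (α_ Y (ᘁX) X).inv ≫ e.hom ▷ X
  have : Mono f := by dsimp only [f]; infer_instance
  have hf : f ≠ 0 := fun h => Simple.not_isZero Y (IsZero.of_mono_eq_zero f h)
  obtain ⟨i, hi⟩ := exists_comp_π_whiskerRight_ne_zero hf
  exact ⟨S i, _, hS i, mono_of_simple hi⟩

/-- A simple object `Y` embeds into `X ⊗ D` for some simple constituent `D` of `Xᘁ ⊗ Y`. -/
theorem exists_simple_mono_tensor_left (X : C) (hX : ¬ IsZero X) (Y : C) [Simple Y] :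
    ∃ (D : C) (f : Y ⟶ X ⊗ D), Simple D ∧ Mono f := by
  obtain ⟨_⟩ := FusionCategory.rigid (C := C)
  have := FusionCategory.simple_unit (C := C)
  have : Mono (η_ X (Xᘁ)) := mono_of_simple (coevaluation_ne_zero_of_left hX)
  -- `- ⊗ Y` is a right adjoint, by rigidity of `Y`.
  have := Functor.preservesMonomorphisms_of_adjunction (tensorRightAdjunction (ᘁY) Y)
  have : Mono (η_ X (Xᘁ) ▷ Y) := (tensorRight Y).map_mono (η_ X (Xᘁ))
  obtain ⟨n, S, hS, ⟨e⟩⟩ := FusionCategory.semisimple ((Xᘁ) ⊗ Y)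
  let f : Y ⟶ X ⊗ (⨁ S) :=
    (λ_ Y).inv ≫ η_ X (Xᘁ) ▷ Y ≫ (α_ X (Xᘁ) Y).hom ≫ X ◁ e.hom
  have : Mono f := by dsimp only [f]; infer_instance
  have hf : f ≠ 0 := fun h => Simple.not_isZero Y (IsZero.of_mono_eq_zero f h)
  obtain ⟨i, hi⟩ := exists_comp_whiskerLeft_π_ne_zero hf
  exact ⟨S i, _, hS i, mono_of_simple hi⟩

theorem vecSubcategory_unit : vecSubcategory C (𝟙_ C) :=
  ⟨1, ⟨(biproductUniqueIso (fun _ : Fin 1 => 𝟙_ C)).symm⟩⟩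

namespace IsGrading

variable {G : Type w} [Group G] {P : G → ObjectProperty C}

theorem of_iso (hP : IsGrading P) {g : G} {X Y : C} (e : X ≅ Y) (hX : P g X) : P g Y :=
  have := hP.iso g
  (P g).prop_of_iso e hX

theorem of_mono (hP : IsGrading P) {g : G} {X Y : C} (f : X ⟶ Y) [Mono f] (hY : P g Y) :
    P g X :=
  have := hP.sub g
  (P g).prop_of_mono f hY

/-- Simple objects are homogeneous. -/
theorem exists_mem_of_simple (hP : IsGrading P) (S : C) [Simple S] : ∃ g, P g S := by
  obtain ⟨n, g, Y, -, hY, ⟨e⟩⟩ := hP.decomposition S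
  have he : e.hom ≠ 0 := fun h => Simple.not_isZero S (IsZero.of_mono_eq_zero e.hom h)
  obtain ⟨i, hi⟩ := exists_comp_π_ne_zero he
  have := mono_of_simple hi
  exact ⟨g i, hP.of_mono (e.hom ≫ biproduct.π Y i) (hY i)⟩

theorem eq_of_mono (hP : IsGrading P) {g h : G} {Y Z : C} [Simple Y] (f : Y ⟶ Z) [Mono f]
    (hY : P g Y) (hZ : P h Z) : g = h := by
  by_contra hgh
  exact Simple.not_isZero Y (IsZero.of_mono_eq_zero f (hP.hom_eq_zero g h hgh Y Z hY hZ f))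

/-- The unit object has degree `1`: its degree is idempotent. -/
theorem unit_mem (hP : IsGrading P) : P 1 (𝟙_ C) := by
  have := FusionCategory.simple_unit (C := C)
  obtain ⟨h, hh⟩ := hP.exists_mem_of_simple (𝟙_ C)
  have h1 : h = h * h := hP.eq_of_mono (λ_ (𝟙_ C)).inv hh (hP.tensor h h _ _ hh hh)
  rwa [left_eq_mul.1 h1] at hh

theorem vecSubcategory_le (hP : IsGrading P) : vecSubcategory C ≤ P 1 := by
  rintro X ⟨n, ⟨e⟩⟩
  exact hP.of_iso e.symm (hP.biproduct 1 n _ fun _ => hP.unit_mem)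

theorem doubleCoset_subset_simplesOf (hP : IsGrading P) {g : G} {X : C} (hX : P g X) :
    doubleCoset (P 1) (P 1) X ⊆ simplesOf (P g) := by
  rintro Y ⟨D, E, -, hD, -, hE, hY, f, hf⟩
  have h := hP.tensor _ _ _ _ (hP.tensor _ _ _ _ hD hX) hE
  rw [one_mul, mul_one] at h
  exact ⟨hY, hP.of_mono f h⟩

theorem simplesOf_subset_leftCoset (hP : IsGrading P) {g : G} {X : C} (hX : P g X)
    (hX0 : ¬ IsZero X) : simplesOf (P g) ⊆ leftCoset (P 1) X := by
  rintro Y ⟨hY, hYg⟩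
  obtain ⟨D, f, hD, hf⟩ := exists_simple_mono_tensor_right X hX0 Y
  obtain ⟨h, hh⟩ := hP.exists_mem_of_simple D
  have h1 : g = h * g := hP.eq_of_mono f hYg (hP.tensor _ _ _ _ hh hX)
  rw [right_eq_mul.1 h1] at hh
  exact ⟨D, 𝟙_ C, hD, hh, FusionCategory.simple_unit, vecSubcategory_unit, hY,
    f ≫ (ρ_ (D ⊗ X)).inv, inferInstance⟩

theorem simplesOf_subset_rightCoset (hP : IsGrading P) {g : G} {X : C} (hX : P g X)
    (hX0 : ¬ IsZero X) : simplesOf (P g) ⊆ rightCoset (P 1) X := by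
  rintro Y ⟨hY, hYg⟩
  obtain ⟨E, f, hE, hf⟩ := exists_simple_mono_tensor_left X hX0 Y
  obtain ⟨h, hh⟩ := hP.exists_mem_of_simple E
  have h1 : g = g * h := hP.eq_of_mono f hYg (hP.tensor _ _ _ _ hX hh)
  rw [left_eq_mul.1 h1] at hh
  exact ⟨𝟙_ C, E, FusionCategory.simple_unit, vecSubcategory_unit, hE, hh, hY,
    f ≫ (λ_ X).inv ▷ E, inferInstance⟩

theorem eq_spannedBy_simplesOf (hP : IsGrading P) (g : G) :
    P g = spannedBy (simplesOf (P g)) := by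
  refine le_antisymm ?_ ?_
  · rintro Z hZ Y ⟨hY, f, hf⟩
    exact ⟨hY, hP.of_mono f hZ⟩
  · intro Z hZ
    obtain ⟨n, S, hS, ⟨e⟩⟩ := FusionCategory.semisimple Z
    exact hP.of_iso e.symm (hP.biproduct g n S fun i =>
      (hZ (S i) ⟨hS i, biproduct.ι S i ≫ e.inv, inferInstance⟩).2)

end IsGrading

end FusionCategories

end FusionCoset

end

theorem mainTheorem3 {G : Type w} [Group G]
    {C : Type u} [Category.{v} C] [Preadditive C] [Linear ℂ C]
    [MonoidalCategory C] [MonoidalPreadditive C] [MonoidalLinear ℂ C]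
    [FusionCoset.FusionCategory C]
    (P : G → ObjectProperty C) (hP : FusionCoset.IsGrading P)
    (hnormal : FusionCoset.IsNormalFusionSubcategory.{v, u, v', u'} (P 1))
    (g : G) (X : C) (hX : P g X) (hX0 : ¬ IsZero X) :
    FusionCoset.simplesOf (P g) = FusionCoset.leftCoset (P 1) X ∧
      FusionCoset.simplesOf (P g) = FusionCoset.rightCoset (P 1) X ∧
      FusionCoset.simplesOf (P g) = FusionCoset.doubleCoset (P 1) (P 1) X ∧
      P g = FusionCoset.spannedBy (FusionCoset.leftCoset (P 1) X) ∧
      P g = FusionCoset.spannedBy (FusionCoset.rightCoset (P 1) X) := by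
  have hl := hP.simplesOf_subset_leftCoset hX hX0
  have hr := hP.simplesOf_subset_rightCoset hX hX0
  have hd := hP.doubleCoset_subset_simplesOf hX
  have hld : FusionCoset.leftCoset (P 1) X ⊆ FusionCoset.doubleCoset (P 1) (P 1) X :=
    FusionCoset.doubleCoset_mono le_rfl hP.vecSubcategory_le X
  have hrd : FusionCoset.rightCoset (P 1) X ⊆ FusionCoset.doubleCoset (P 1) (P 1) X :=
    FusionCoset.doubleCoset_mono hP.vecSubcategory_le le_rfl X
  have hL := hl.antisymm (hld.trans hd)
  have hR := hr.antisymm (hrd.trans hd)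
  refine ⟨hL, hR, (hl.trans hld).antisymm hd, ?_, ?_⟩
  · rw [← hL]
    exact hP.eq_spannedBy_simplesOf g
  · rw [← hR]
    exact hP.eq_spannedBy_simplesOf g
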